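/- Work in ZFC. A set $X$ is $\Sigma_1(y)$-definable if $X=\{x \mid \varphi(x,y)\}$ for some $\Sigma_1$-formula $\varphi$ of the language of set theory (without further parameters). A wellordering $\lhd$ of a set $X$ is a good $\Sigma_1(y)$-wellordering of $X$ if the set $\{\{x\in X \mid x\lhd z\}\mid z\in X\}$ of all its proper initial segments is $\Sigma_1(y)$-definable. Let $\delta$ be a measurable cardinal such that the $\mathrm{GCH}$ holds from $\delta$ upwards, i.e. $2^{\mu}=\mu^{+}$ for every cardinal $\mu\geq\delta$. Let $\kappa\geq\delta$ be a cardinal such that there is a good $\Sigma_1(\kappa)$-wellordering of the power set $\mathcal{P}(\kappa)$. Then: (i) there is a cardinal $\nu$ with $\mathrm{cof}(\nu)=\delta$ and $\nu\leq\kappa\leq\nu^{+}$; (ii) there is no measurable cardinal $\varepsilon$ with $\delta<\varepsilon\leq\kappa$. -/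

import Mathlib

open FirstOrder

universe u

/-! ### The language of set theory and the Lévy classes `Δ₀` and `Σ₁` -/

/-- The relation symbols of the language of set theory: one binary symbol. -/
inductive MembershipRel : ℕ → Type
  | mem : MembershipRel 2

/-- The first-order language of set theory, with `∈` as its only non-logical symbol. -/
def setLanguage : FirstOrder.Language.{0, 0} where
  Functions := fun _ => Empty
  Relations := MembershipRel

/-- The universe of sets, with the true membership relation. -/
instance zfsetStructure : setLanguage.Structure ZFSet.{u} where
  funMap := fun f _ => f.elim
  RelMap := fun {_} R =>
    match R with
    | MembershipRel.mem => fun v => v 0 ∈ v 1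

/-- The atomic formula `s ∈ t`. -/
def memFormula {α : Type} {n : ℕ} (s t : setLanguage.Term (α ⊕ Fin n)) :
    setLanguage.BoundedFormula α n :=
  Language.Relations.boundedFormula₂ (L := setLanguage) MembershipRel.mem s t

/-- `Δ₀`-formulas: built from atomic formulas with propositional connectives and bounded
quantification. Since `¬ φ` is `φ → ⊥`, the clauses `falsum` and `imp` yield all connectives, and
bounded existential quantification is `¬ ∀ v ∈ x, ¬ φ`. In the clause `ball` the quantified
variable is `&n`, and the bound `x` is one of the variables of the ambient context, so it differs
from the quantified variable. -/
inductive IsDelta0 {α : Type} : ∀ {n : ℕ}, setLanguage.BoundedFormula α n → Prop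
  | falsum {n : ℕ} : IsDelta0 (⊥ : setLanguage.BoundedFormula α n)
  | equal {n : ℕ} (s t : setLanguage.Term (α ⊕ Fin n)) :
      IsDelta0 (Language.BoundedFormula.equal s t)
  | mem {n : ℕ} (s t : setLanguage.Term (α ⊕ Fin n)) : IsDelta0 (memFormula s t)
  | imp {n : ℕ} {φ ψ : setLanguage.BoundedFormula α n} :
      IsDelta0 φ → IsDelta0 ψ → IsDelta0 (φ.imp ψ)
  | ball {n : ℕ} (x : α ⊕ Fin n) {φ : setLanguage.BoundedFormula α (n + 1)} :
      IsDelta0 φ →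
      IsDelta0 (((memFormula (Language.Term.var (Sum.inr (Fin.last n)))
        (Language.Term.var (Sum.map id Fin.castSucc x))).imp φ).all)

/-- `Σ₁`-formulas: a (possibly empty) block of unbounded existential quantifiers followed by a
`Δ₀`-formula. -/
inductive IsSigma1 {α : Type} : ∀ {n : ℕ}, setLanguage.BoundedFormula α n → Prop
  | of_delta0 {n : ℕ} {φ : setLanguage.BoundedFormula α n} : IsDelta0 φ → IsSigma1 φ
  | ex {n : ℕ} {φ : setLanguage.BoundedFormula α (n + 1)} : IsSigma1 φ → IsSigma1 φ.ex

/-- `X` is `Σ₁(y₀, …, yₙ₋₁)`-definable: `X = {x | φ(x, y₀, …, yₙ₋₁)}` for a `Σ₁`-formula `φ`. -/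
def IsSigma1Definable {n : ℕ} (y : Fin n → ZFSet.{u}) (X : Set ZFSet.{u}) : Prop :=
  ∃ φ : setLanguage.Formula (Fin (n + 1)),
    IsSigma1 φ ∧ X = {x | φ.Realize (Fin.cons x y : Fin (n + 1) → ZFSet.{u})}

/-! ### Good `Σ₁`-wellorderings -/

/-- `r` is a (strict) wellordering of the set `X`; only the restriction of `r` to `X` matters. -/
def IsWellOrderingOf (X : ZFSet.{u}) (r : ZFSet.{u} → ZFSet.{u} → Prop) : Prop :=
  IsWellOrder {x : ZFSet.{u} // x ∈ X} (fun a b => r a.1 b.1)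

/-- The collection `{{x ∈ X | r x y} | y ∈ X}` of all proper initial segments of `r` on `X`. -/
def initialSegments (X : ZFSet.{u}) (r : ZFSet.{u} → ZFSet.{u} → Prop) : Set ZFSet.{u} :=
  {A | ∃ y ∈ X, A = ZFSet.sep (fun x => r x y) X}

/-- `r` is a good `Σ₁(y₀, …, yₙ₋₁)`-wellordering of `X`. -/
def IsGoodSigma1WellOrdering {n : ℕ} (y : Fin n → ZFSet.{u}) (X : ZFSet.{u})
    (r : ZFSet.{u} → ZFSet.{u} → Prop) : Prop :=
  IsWellOrderingOf X r ∧ IsSigma1Definable y (initialSegments X r)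

/-! ### Cardinals -/

/-- `δ` is a measurable cardinal: it is uncountable and there is a nonprincipal `δ`-complete
ultrafilter on (a set of cardinality) `δ`. -/
def IsMeasurableCardinal (δ : Cardinal.{u}) : Prop :=
  Cardinal.aleph0 < δ ∧
    ∃ U : Ultrafilter δ.out, (∀ a : δ.out, {a} ∉ U) ∧ CardinalInterFilter (U : Filter δ.out) δ

/-- The generalized continuum hypothesis holds at every cardinal from `δ` upwards. -/
def GCHFrom (δ : Cardinal.{u}) : Prop :=
  ∀ μ : Cardinal.{u}, δ ≤ μ → (2 : Cardinal.{u}) ^ μ = Order.succ μ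

/-! Suppose (i) fails, and let `j : V → M` be the collapsed ultrapower by a `δ`-complete
nonprincipal ultrafilter on a set of size `δ`. Since `j` is continuous at limit ordinals of
cofinality other than `δ`, cardinal arithmetic under GCH gives `j(κ) = κ`. As `Σ₁` truth passes from
`M` up to `V`, `j` maps initial segments of the good wellordering to initial segments, and this
forces `𝒫(κ) ⊆ M` (`mem_range_ultraCollapse_of_isGoodSigma1WellOrdering`). But `j[κ] ⊆ κ` is not in
`M` because `κ > δ` (`sep_ultraEmb_notMem_range`), a contradiction. For (ii), a measurable `ε` in
`(δ, κ]` also satisfies (i). The two resulting cardinals are equal or one is the successor of the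
other, which their cofinalities `δ` and `ε` rule out. -/

/-! ### The collapsed ultrapower of the universe of sets -/

section Ultrapower

open Filter

variable {I : Type u} (U : Ultrafilter I)

/-- Membership in the ultrapower of the universe of sets by `U`, on representing functions. -/
def UltraMem (f g : I → ZFSet.{u}) : Prop :=
  ∀ᶠ i in (U : Filter I), f i ∈ g i

/-- A set which represents all the members of the class of `g` in the ultrapower. -/
def ultraMembers (g : I → ZFSet.{u}) : Set (I → ZFSet.{u}) :=
  {h | (∀ i, h i ∈ insert ∅ (g i)) ∧ UltraMem U h g}

/-- Confining the values at `i` to `insert ∅ (g i)` leaves only a set of functions, so the collapse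
can be defined by `ZFSet.range`. -/
instance small_ultraMembers (g : I → ZFSet.{u}) : Small.{u} (ultraMembers U g) :=
  small_of_injective (β := ∀ i, {x : ZFSet.{u} // x ∈ insert ∅ (g i)})
    (f := fun h i => ⟨h.1 i, h.2.1 i⟩)
    fun _ _ h => Subtype.ext (funext fun i => congrArg Subtype.val (congrFun h i))

theorem exists_mem_ultraMembers {U : Ultrafilter I}
    {f g h : I → ZFSet.{u}} (hfg : f =ᶠ[U] g) (hh : UltraMem U h f) :
    ∃ h' ∈ ultraMembers U g, h =ᶠ[U] h' := by
  classical
  have hg : UltraMem U h g := by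
    filter_upwards [hfg, hh] with i h1 h2
    rwa [← h1]
  have he : h =ᶠ[U] fun i => if h i ∈ g i then h i else ∅ := by
    filter_upwards [hg] with i hi
    rw [if_pos hi]
  refine ⟨fun i => if h i ∈ g i then h i else ∅, ⟨fun i => ?_, ?_⟩, he⟩
  · dsimp only
    split_ifs with hi
    · exact ZFSet.mem_insert_of_mem _ hi
    · exact ZFSet.mem_insert _ _
  · filter_upwards [hg] with i hi
    rwa [if_pos hi]

variable [CountableInterFilter (U : Filter I)]

theorem wellFounded_ultraMem : WellFounded (UltraMem U) := by
  refine wellFounded_iff_isEmpty_descending_chain.2 ⟨fun ⟨s, hs⟩ => ?_⟩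
  obtain ⟨i, hi⟩ := (eventually_countable_forall.2 hs).exists
  exact (wellFounded_iff_isEmpty_descending_chain.1 ZFSet.mem_wf).false
    ⟨fun n => s n i, hi⟩

/-- The Mostowski collapse of the ultrapower of the universe of sets by `U`, as a map on
representing functions. -/
noncomputable def ultraCollapse : (I → ZFSet.{u}) → ZFSet.{u} :=
  (wellFounded_ultraMem U).fix fun g rec => ZFSet.range fun h : ultraMembers U g => rec h.1 h.2.2

/-- The elementary embedding of the universe into its ultrapower. -/
noncomputable def ultraEmb (x : ZFSet.{u}) : ZFSet.{u} :=
  ultraCollapse U fun _ => x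

theorem ultraCollapse_eq (g : I → ZFSet.{u}) :
    ultraCollapse U g = ZFSet.range fun h : ultraMembers U g => ultraCollapse U h.1 :=
  (wellFounded_ultraMem U).fix_eq _ g

variable {U}

theorem ultraCollapse_congr {f g : I → ZFSet.{u}} (hfg : f =ᶠ[U] g) :
    ultraCollapse U f = ultraCollapse U g := by
  induction f using (wellFounded_ultraMem U).induction generalizing g with
  | _ f ih =>
    ext y
    rw [ultraCollapse_eq U f, ultraCollapse_eq U g, ZFSet.mem_range, ZFSet.mem_range]
    constructor
    · rintro ⟨⟨h, hh⟩, rfl⟩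
      obtain ⟨h', hh', he⟩ := exists_mem_ultraMembers hfg hh.2
      exact ⟨⟨h', hh'⟩, (ih h hh.2 he).symm⟩
    · rintro ⟨⟨h, hh⟩, rfl⟩
      obtain ⟨h', hh', he⟩ := exists_mem_ultraMembers hfg.symm hh.2
      exact ⟨⟨h', hh'⟩, ih h' hh'.2 he.symm⟩

theorem mem_ultraCollapse {g : I → ZFSet.{u}} {y : ZFSet.{u}} :
    y ∈ ultraCollapse U g ↔ ∃ h, UltraMem U h g ∧ ultraCollapse U h = y := by
  rw [ultraCollapse_eq, ZFSet.mem_range]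
  constructor
  · rintro ⟨⟨h, hh⟩, rfl⟩
    exact ⟨h, hh.2, rfl⟩
  · rintro ⟨h, hh, rfl⟩
    obtain ⟨h', hh', he⟩ := exists_mem_ultraMembers (EventuallyEq.refl _ g) hh
    exact ⟨⟨h', hh'⟩, (ultraCollapse_congr he).symm⟩

theorem ultraCollapse_eq_ultraCollapse {f g : I → ZFSet.{u}} :
    ultraCollapse U f = ultraCollapse U g ↔ f =ᶠ[U] g := by
  refine ⟨fun hfg => ?_, ultraCollapse_congr⟩
  induction f using (wellFounded_ultraMem U).induction generalizing g with
  | _ f ih =>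
    by_contra hne
    have hne' : ∀ᶠ i in (U : Filter I), f i ≠ g i := Ultrafilter.eventually_not.2 hne
    -- The ultrafilter decides on which side the difference lies almost everywhere; choosing
    -- elements of the difference gives a member of one class that is not in the other.
    have hsplit : (∀ᶠ i in (U : Filter I), ∃ y, y ∈ f i ∧ y ∉ g i) ∨
        ∀ᶠ i in (U : Filter I), ∃ y, y ∈ g i ∧ y ∉ f i := by
      rw [← Ultrafilter.eventually_or]
      filter_upwards [hne'] with i hi
      by_contra! hcon
      exact hi (ZFSet.ext fun y => ⟨hcon.1 y, hcon.2 y⟩)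
    rcases hsplit with h | h
    · obtain ⟨h, hh⟩ := h.choice
      have h1 : UltraMem U h f := hh.mono fun i hi => hi.1
      obtain ⟨h', hh', he⟩ := mem_ultraCollapse.1 (hfg ▸ mem_ultraCollapse.2 ⟨h, h1, rfl⟩)
      obtain ⟨i, hi⟩ := (hh.and (hh'.and (ih h h1 he.symm))).exists
      exact hi.1.2 (hi.2.2 ▸ hi.2.1)
    · obtain ⟨h, hh⟩ := h.choice
      have h1 : UltraMem U h g := hh.mono fun i hi => hi.1
      obtain ⟨h', hh', he⟩ := mem_ultraCollapse.1 (hfg.symm ▸ mem_ultraCollapse.2 ⟨h, h1, rfl⟩)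
      obtain ⟨i, hi⟩ := (hh.and (hh'.and (ih h' hh' he))).exists
      exact hi.1.2 (hi.2.2 ▸ hi.2.1)

theorem ultraCollapse_mem_ultraCollapse {f g : I → ZFSet.{u}} :
    ultraCollapse U f ∈ ultraCollapse U g ↔ ∀ᶠ i in (U : Filter I), f i ∈ g i := by
  rw [mem_ultraCollapse]
  constructor
  · rintro ⟨h, hh, he⟩
    filter_upwards [hh, ultraCollapse_eq_ultraCollapse.1 he] with i h1 h2
    rwa [← h2]
  · exact fun h => ⟨f, h, rfl⟩

theorem ultraCollapse_subset_ultraCollapse {f g : I → ZFSet.{u}}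
    (h : ∀ᶠ i in (U : Filter I), f i ⊆ g i) :
    ultraCollapse U f ⊆ ultraCollapse U g := by
  intro y hy
  obtain ⟨a, ha, rfl⟩ := mem_ultraCollapse.1 hy
  exact ultraCollapse_mem_ultraCollapse.2 ((h.and ha).mono fun i hi => hi.1 hi.2)

theorem ultraEmb_mem_ultraEmb {x y : ZFSet.{u}} : ultraEmb U x ∈ ultraEmb U y ↔ x ∈ y := by
  rw [ultraEmb, ultraEmb, ultraCollapse_mem_ultraCollapse, eventually_const]

theorem ultraEmb_subset_ultraEmb {x y : ZFSet.{u}} (h : x ⊆ y) : ultraEmb U x ⊆ ultraEmb U y :=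
  ultraCollapse_subset_ultraCollapse (Eventually.of_forall fun _ => h)

theorem mem_range_ultraCollapse_of_mem {x y : ZFSet.{u}} (hx : x ∈ Set.range (ultraCollapse U))
    (hy : y ∈ x) : y ∈ Set.range (ultraCollapse U) := by
  obtain ⟨f, rfl⟩ := hx
  obtain ⟨g, -, rfl⟩ := mem_ultraCollapse.1 hy
  exact ⟨g, rfl⟩

/-! ### Łoś's theorem for the collapsed ultrapower -/

theorem realize_term_ultraCollapse {β : Type} (t : setLanguage.Term β) (v : β → I → ZFSet.{u}) :
    t.realize (fun b => ultraCollapse U (v b)) =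
      ultraCollapse U fun i => t.realize fun b => v b i := by
  cases t with
  | var b => rfl
  | func f _ => exact f.elim

theorem realize_memFormula {α : Type} {n : ℕ} (s t : setLanguage.Term (α ⊕ Fin n))
    (v : α → ZFSet.{u}) (xs : Fin n → ZFSet.{u}) :
    (memFormula s t).Realize v xs ↔ s.realize (Sum.elim v xs) ∈ t.realize (Sum.elim v xs) := by
  exact Language.BoundedFormula.realize_rel₂

theorem sumElim_ultraCollapse {α : Type} {n : ℕ} (v : α → I → ZFSet.{u})
    (xs : Fin n → I → ZFSet.{u}) :
    Sum.elim (fun a => ultraCollapse U (v a)) (fun k => ultraCollapse U (xs k)) =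
      fun b => ultraCollapse U (Sum.elim v xs b) := by
  funext b
  cases b <;> rfl

theorem sumElim_apply {α : Type} {n : ℕ} (v : α → I → ZFSet.{u}) (xs : Fin n → I → ZFSet.{u})
    (i : I) : (Sum.elim (fun a => v a i) fun k => xs k i) = fun b => Sum.elim v xs b i := by
  funext b
  cases b <;> rfl

theorem snoc_ultraCollapse {n : ℕ} (xs : Fin n → I → ZFSet.{u}) (h : I → ZFSet.{u}) :
    (Fin.snoc (fun k => ultraCollapse U (xs k)) (ultraCollapse U h) : Fin (n + 1) → ZFSet.{u}) =
      fun k => ultraCollapse U ((Fin.snoc xs h : Fin (n + 1) → I → ZFSet.{u}) k) := by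
  funext k
  refine Fin.lastCases ?_ (fun k => ?_) k <;> simp

theorem snoc_apply {n : ℕ} (xs : Fin n → I → ZFSet.{u}) (h : I → ZFSet.{u}) (i : I) :
    (Fin.snoc (fun k => xs k i) (h i) : Fin (n + 1) → ZFSet.{u}) =
      fun k => (Fin.snoc xs h : Fin (n + 1) → I → ZFSet.{u}) k i := by
  funext k
  refine Fin.lastCases ?_ (fun k => ?_) k <;> simp

theorem realize_ball {α : Type} {n : ℕ} (x : α ⊕ Fin n)
    (φ : setLanguage.BoundedFormula α (n + 1)) (v : α → ZFSet.{u}) (xs : Fin n → ZFSet.{u}) :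
    (((memFormula (Language.Term.var (Sum.inr (Fin.last n)))
      (Language.Term.var (Sum.map id Fin.castSucc x))).imp φ).all).Realize v xs ↔
      ∀ y ∈ Sum.elim v xs x, φ.Realize v (Fin.snoc xs y) := by
  rw [Language.BoundedFormula.realize_all]
  refine forall_congr' fun y => ?_
  rw [Language.BoundedFormula.realize_imp, realize_memFormula]
  cases x <;> simp

/-- Truth is evaluated in `V`, not in the ultrapower. The two agree on `Δ₀`-formulas because the
range of the collapse is transitive, so bounded quantifiers do not leave it. -/
theorem IsDelta0.realize_ultraCollapse {α : Type} {n : ℕ} {φ : setLanguage.BoundedFormula α n}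
    (hφ : IsDelta0 φ) (v : α → I → ZFSet.{u}) (xs : Fin n → I → ZFSet.{u}) :
    φ.Realize (fun a => ultraCollapse U (v a)) (fun k => ultraCollapse U (xs k)) ↔
      ∀ᶠ i in (U : Filter I), φ.Realize (fun a => v a i) fun k => xs k i := by
  induction hφ with
  | falsum => simp [Language.BoundedFormula.Realize, U.neBot.ne]
  | equal s t =>
    simp only [Language.BoundedFormula.Realize, sumElim_ultraCollapse, sumElim_apply,
      realize_term_ultraCollapse, ultraCollapse_eq_ultraCollapse]
    rfl
  | mem s t =>
    simp only [realize_memFormula, sumElim_ultraCollapse, sumElim_apply,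
      realize_term_ultraCollapse, ultraCollapse_mem_ultraCollapse]
  | imp _ _ ih₁ ih₂ =>
    simp only [Language.BoundedFormula.realize_imp, ih₁, ih₂, Ultrafilter.eventually_imp]
  | ball x _ ih =>
    simp only [realize_ball, sumElim_ultraCollapse, sumElim_apply]
    constructor
    · intro h
      by_contra hcon
      have hcon' := Ultrafilter.eventually_not.2 hcon
      simp only [not_forall, exists_prop] at hcon'
      obtain ⟨g, hg⟩ := hcon'.choice
      have h1 := h _ (ultraCollapse_mem_ultraCollapse.2 (hg.mono fun i hi => hi.1))
      rw [snoc_ultraCollapse, ih] at h1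
      obtain ⟨i, hi⟩ := (hg.and h1).exists
      rw [snoc_apply] at hi
      exact hi.1.2 hi.2
    · intro h y hy
      obtain ⟨g, hg, rfl⟩ := mem_ultraCollapse.1 hy
      rw [snoc_ultraCollapse, ih]
      filter_upwards [h, hg] with i h1 h2
      rw [← snoc_apply]
      exact h1 _ h2

/-- Only one direction survives: a witness in `V` need not lie in the range of the collapse. -/
theorem IsSigma1.realize_ultraCollapse {α : Type} {n : ℕ} {φ : setLanguage.BoundedFormula α n}
    (hφ : IsSigma1 φ) (v : α → I → ZFSet.{u}) (xs : Fin n → I → ZFSet.{u})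
    (h : ∀ᶠ i in (U : Filter I), φ.Realize (fun a => v a i) fun k => xs k i) :
    φ.Realize (fun a => ultraCollapse U (v a)) (fun k => ultraCollapse U (xs k)) := by
  induction hφ with
  | of_delta0 hφ => exact (hφ.realize_ultraCollapse v xs).2 h
  | ex _ ih =>
    simp only [Language.BoundedFormula.realize_ex] at h ⊢
    obtain ⟨g, hg⟩ := h.choice
    refine ⟨ultraCollapse U g, ?_⟩
    rw [snoc_ultraCollapse]
    refine ih _ (hg.mono fun i hi => ?_)
    rwa [← snoc_apply]

/-! ### Good wellorderings of a power set and the ultrapower -/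

theorem IsSigma1Definable.ultraEmb_mem {n : ℕ} {y : Fin n → ZFSet.{u}} {X : Set ZFSet.{u}}
    (hX : IsSigma1Definable y X) (hy : ∀ k, ultraEmb U (y k) = y k) {x : ZFSet.{u}} (hx : x ∈ X) :
    ultraEmb U x ∈ X := by
  obtain ⟨φ, hφ, rfl⟩ := hX
  have key := hφ.realize_ultraCollapse (U := U)
    (fun a _ => (Fin.cons x y : Fin (n + 1) → ZFSet.{u}) a) (fun k : Fin 0 => k.elim0)
    (Eventually.of_forall fun _ => by
      have h : φ.Realize (Fin.cons x y : Fin (n + 1) → ZFSet.{u}) := hx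
      unfold Language.Formula.Realize at h
      convert h)
  have hcons : (fun a => ultraCollapse U fun _ => (Fin.cons x y : Fin (n + 1) → ZFSet.{u}) a) =
      Fin.cons (ultraEmb U x) y := by
    funext a
    exact Fin.cases rfl (fun k => hy k) a
  rw [hcons] at key
  change φ.Realize _
  unfold Language.Formula.Realize
  convert key

/-- The hypothesis yields `σ a ≤ k a < σ b` for `a < b`, so `σ` is strictly increasing and `a ≤ σ a
≤ k a`. -/
theorem eq_or_rel_of_rel_iff_rel {X : Type*} (r : X → X → Prop) [hr : IsWellOrder X r]
    {k σ : X → X} (h : ∀ a b, r (k a) (σ b) ↔ r a b) (a : X) :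
    k a = a ∨ r a (σ (k a)) := by
  let : LinearOrder X := IsWellOrder.linearOrder r
  have : WellFoundedLT X := ⟨hr.wf⟩
  have h' : ∀ a b, k a < σ b ↔ a < b := h
  have le_k : ∀ a, σ a ≤ k a := fun a => not_lt.1 fun hlt => lt_irrefl a ((h' a a).1 hlt)
  have hmono : StrictMono σ := fun a b hab => (le_k a).trans_lt ((h' a b).2 hab)
  have hle : ∀ a, a ≤ σ a := fun a => hmono.le_apply
  rcases ((hle a).trans (le_k a)).eq_or_lt with heq | hlt
  · exact Or.inl heq.symm
  · exact Or.inr (hlt.trans_le (hle _))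

/-- Let `σ b` be the point whose initial segment is `j` of the segment below `b`. Either `z = j(z)`,
or `z` precedes `σ (j z)` and hence is an element of `j` of a segment; both put `z` in the
transitive class `M`. -/
theorem mem_range_ultraCollapse_of_isGoodSigma1WellOrdering {s : ZFSet.{u}}
    (hs : ultraEmb U s = s) {r : ZFSet.{u} → ZFSet.{u} → Prop}
    (hr : IsGoodSigma1WellOrdering ![s] s.powerset r) {z : ZFSet.{u}} (hz : z ⊆ s) :
    z ∈ Set.range (ultraCollapse U) := by
  obtain ⟨hwo, hdef⟩ := hr
  let X := {x : ZFSet.{u} // x ∈ s.powerset}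
  have : IsWellOrder X (fun a b => r a.1 b.1) := hwo
  let k : X → X := fun x => ⟨ultraEmb U x.1, ZFSet.mem_powerset.2 <| by
    conv_rhs => rw [← hs]
    exact ultraEmb_subset_ultraEmb (ZFSet.mem_powerset.1 x.2)⟩
  let seg : X → ZFSet.{u} := fun x => ZFSet.sep (fun y => r y x.1) s.powerset
  have mem_seg : ∀ a b : X, a.1 ∈ seg b ↔ r a.1 b.1 := fun a b => by
    rw [ZFSet.mem_sep]
    exact ⟨fun h => h.2, fun h => ⟨a.2, h⟩⟩
  have hseg : ∀ x : X, ∃ x' : X, ultraEmb U (seg x) = seg x' := fun x => by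
    obtain ⟨y, hy, he⟩ := hdef.ultraEmb_mem (U := U) (fun k => by
      rw [Matrix.cons_val_fin_one]
      exact hs) ⟨x.1, x.2, rfl⟩
    exact ⟨⟨y, hy⟩, he⟩
  choose σ hσ using hseg
  have mem_σ : ∀ a b : X, r (k a).1 (σ b).1 ↔ r a.1 b.1 := fun a b => by
    rw [← mem_seg, ← hσ, ← mem_seg a b]
    exact ultraEmb_mem_ultraEmb
  let x : X := ⟨z, ZFSet.mem_powerset.2 hz⟩
  rcases eq_or_rel_of_rel_iff_rel (fun a b : X => r a.1 b.1) mem_σ x with h | h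
  · exact ⟨_, congrArg Subtype.val h⟩
  · refine mem_range_ultraCollapse_of_mem (x := ultraEmb U (seg (k x))) ⟨_, rfl⟩ ?_
    rw [hσ]
    exact (mem_seg x _).2 h

/-! ### The ultrapower does not contain the pointwise image of a large fixed set -/

open Cardinal in
theorem exists_injective_mem {ι : Type u} (f : ι → ZFSet.{u}) {s : Set ι}
    (hf : ∀ i ∈ s, #ι ≤ (f i).card) :
    ∃ g : ι → ZFSet.{u}, Set.InjOn g s ∧ ∀ i ∈ s, g i ∈ f i := by
  classical
  obtain ⟨r, hr, hord⟩ := exists_ord_eq ι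
  let P : ∀ i, (∀ j, r j i → ZFSet.{u}) → ZFSet.{u} → Prop := fun i rec y =>
    y ∈ f i ∧ ∀ j (hj : r j i), rec j hj ≠ y
  -- Recursion along a wellordering of type `(#ι).ord`: fewer than `#ι` values are excluded at each
  -- stage. Values outside `s` are arbitrary.
  let g : ι → ZFSet.{u} := hr.wf.fix fun i rec => Classical.epsilon (P i rec)
  have hg : ∀ i ∈ s, g i ∈ f i ∧ ∀ j, r j i → g j ≠ g i := by
    intro i hi
    have hex : ∃ y, P i (fun j _ => g j) y := by
      by_contra! hcon
      have hsub : f i ⊆ ZFSet.range fun j : {j // r j i} => g j.1 := fun y hy => by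
        by_contra hy'
        exact hcon y ⟨hy, fun j hj he => hy' (ZFSet.mem_range.2 ⟨⟨j, hj⟩, he⟩)⟩
      have h1 : (f i).card ≤ #{j // r j i} := by
        refine (ZFSet.card_mono hsub).trans ?_
        simpa using ZFSet.lift_card_range_le (f := fun j : {j // r j i} => g j.1)
      have h2 : #{j // r j i} < #ι := by
        have := Ordinal.typein_lt_type r i
        rw [← hord, lt_ord] at this
        exact this
      exact absurd (hf i hi) (h1.trans_lt h2).not_ge
    have heq : g i = Classical.epsilon (P i fun j _ => g j) :=
      hr.wf.fix_eq (fun i rec => Classical.epsilon (P i rec)) i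
    have hspec := Classical.epsilon_spec hex
    rwa [← heq] at hspec
  refine ⟨g, fun i hi j hj he => ?_, fun i hi => (hg i hi).1⟩
  rcases trichotomous_of r i j with h | h | h
  · exact absurd he ((hg j hj).2 i h)
  · exact h
  · exact absurd he.symm ((hg i hi).2 j h)

open Cardinal in
-- Let `f` represent `j[s]`. If almost all `f i` have size at least `#I`, an injective choice `g i ∈
-- f i` represents some `j(x)`, so `g` is constant on a set in `U`, which must be a singleton.
-- Otherwise almost all `f i` are small and their union, of size at most `#I`, would have to cover
-- `s`.
theorem sep_ultraEmb_notMem_range (hU : ∀ a : I, {a} ∉ U) (hI : ℵ₀ ≤ #I) {s : ZFSet.{u}}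
    (hs : ultraEmb U s = s) (hcard : #I < s.card) :
    ZFSet.sep (fun y => ∃ x, ultraEmb U x = y) s ∉ Set.range (ultraCollapse U) := by
  classical
  rintro ⟨f, hf⟩
  have hmem : ∀ x ∈ s, ∀ᶠ i in (U : Filter I), x ∈ f i := fun x hx => by
    have hx' : ultraEmb U x ∈ ultraEmb U s := ultraEmb_mem_ultraEmb.2 hx
    rw [hs] at hx'
    refine ultraCollapse_mem_ultraCollapse (U := U) (f := fun _ => x) |>.1 ?_
    rw [hf, ZFSet.mem_sep]
    exact ⟨hx', x, rfl⟩
  rcases Ultrafilter.em U fun i => #I ≤ (f i).card with h | h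
  · obtain ⟨g, hinj, hg⟩ := exists_injective_mem f (s := {i | #I ≤ (f i).card}) fun i hi => hi
    have h1 : ultraCollapse U g ∈ ultraCollapse U f :=
      ultraCollapse_mem_ultraCollapse.2 (h.mono fun i hi => hg i hi)
    rw [hf, ZFSet.mem_sep] at h1
    obtain ⟨-, x, hx⟩ := h1
    have h2 := (ultraCollapse_eq_ultraCollapse.1 hx).and h
    obtain ⟨a, ha⟩ := h2.exists
    refine hU a (mem_of_superset h2 fun i hi => ?_)
    exact hinj hi.2 ha.2 (hi.1.symm.trans ha.1)
  -- Emptying `f` on the exceptional null set makes the bound hold at every index.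
  · let F : I → ZFSet.{u} := fun i => if #I ≤ (f i).card then ∅ else f i
    have hF : ∀ i, (F i).card ≤ #I := fun i => by
      by_cases hi : #I ≤ (f i).card
      · simp [F, hi]
      · simpa [F, hi] using (not_le.1 hi).le
    have hunion : (ZFSet.iUnion F).card ≤ #I := by
      have := ZFSet.lift_card_iUnion_le_sum_card (f := F)
      rw [lift_id] at this
      refine this.trans ((sum_le_sum _ (fun _ => #I) hF).trans ?_)
      rw [sum_const', mul_eq_self hI]
    have hns : ¬ s ⊆ ZFSet.iUnion F := fun hsub =>
      (hcard.trans_le ((ZFSet.card_mono hsub).trans hunion)).false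
    obtain ⟨x, hx, hx'⟩ : ∃ x ∈ s, x ∉ ZFSet.iUnion F := by
      by_contra! hcon
      exact hns hcon
    obtain ⟨i, hi⟩ := ((hmem x hx).and h).exists
    refine hx' (ZFSet.mem_iUnion.2 ⟨i, ?_⟩)
    simpa only [F, if_neg hi.2] using hi.1

end Ultrapower

section Ultrapower

open Filter Cardinal

variable {I : Type u} {U : Ultrafilter I}

/-! ### Cardinals fixed by the ultrapower embedding -/

/-- This is continuity of `j` at `o`. Below `#I`, completeness lets `f` exceed a whole cofinal set
at once if it is unbounded; above `#I`, the values of `f` cannot be cofinal. -/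
theorem exists_eventually_mem_toZFSet [CardinalInterFilter (U : Filter I) #I] {o : Ordinal.{u}}
    (ho : Order.IsSuccLimit o) (hcof : o.cof ≠ #I) {f : I → ZFSet.{u}}
    (hf : ∀ᶠ i in (U : Filter I), f i ∈ o.toZFSet) :
    ∃ β < o, ∀ᶠ i in (U : Filter I), f i ∈ β.toZFSet := by
  classical
  have hrank : ∀ {x : ZFSet.{u}} {β : Ordinal.{u}}, x ∈ o.toZFSet →
      (x ∈ β.toZFSet ↔ x.rank < β) := fun {x β} hx => by
    obtain ⟨a, -, rfl⟩ := Ordinal.mem_toZFSet_iff.1 hx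
    rw [Ordinal.toZFSet_mem_toZFSet_iff, Ordinal.rank_toZFSet]
  have hlt : ∀ᶠ i in (U : Filter I), (f i).rank < o := hf.mono fun i hi => (hrank hi).1 hi
  rcases hcof.lt_or_gt with hc | hc
  · by_contra! hcon
    obtain ⟨S, hS, hS'⟩ := Order.exists_cof_eq o.ToType
    rw [Ordinal.cof_toType] at hS'
    have hall : ∀ᶠ i in (U : Filter I), ∀ b : S, (b.1.toOrd : Ordinal) < (f i).rank := by
      refine (eventually_cardinal_forall (c := #I) (hS' ▸ hc)).2 fun b => ?_
      filter_upwards [hcon _ (ho.succ_lt (Set.mem_Iio.1 b.1.toOrd.2)), hf]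
        with i h1 h2
      rw [hrank h2, not_lt] at h1
      exact Order.succ_le_iff.1 h1
    obtain ⟨i, h1, h2⟩ := (hall.and hlt).exists
    obtain ⟨b, hb, hle⟩ := hS (Ordinal.ToType.mk ⟨(f i).rank, h2⟩)
    rw [← OrderIso.le_symm_apply] at hle
    exact (hle.trans_lt (h1 ⟨b, hb⟩)).false
  · let g : I → Ordinal.{u} := fun i => if (f i).rank < o then (f i).rank else 0
    have hg : ∀ i, g i < o := fun i => by
      dsimp only [g]
      split_ifs with hi
      · exact hi
      · exact ho.bot_lt
    refine ⟨⨆ i, g i + 1, Ordinal.iSup_add_one_lt_of_lt_cof hc hg, ?_⟩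
    filter_upwards [hf, hlt] with i h1 h2
    rw [hrank h1]
    have := Ordinal.lt_iSup_add_one g i
    simpa only [g, if_pos h2] using this

theorem ZFSet.card_le_card_iff {x y : ZFSet.{u}} :
    x.card ≤ y.card ↔ ∃ F : ZFSet.{u} → ZFSet.{u}, (∀ a ∈ x, F a ∈ y) ∧
      ∀ a ∈ x, ∀ b ∈ x, F a = F b → a = b := by
  classical
  rw [← Cardinal.lift_le.{u + 1}, ← ZFSet.cardinalMk_coe_sort, ← ZFSet.cardinalMk_coe_sort]
  constructor
  · rintro ⟨e⟩
    refine ⟨fun a => if ha : a ∈ x then (e ⟨a, ha⟩).1 else ∅, fun a ha => ?_,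
      fun a ha b hb hab => ?_⟩
    · simp only [dif_pos ha]
      exact (e ⟨a, ha⟩).2
    · simp only [dif_pos ha, dif_pos hb] at hab
      exact congrArg Subtype.val (e.injective (Subtype.ext hab))
  · rintro ⟨F, hF, hinj⟩
    exact mk_le_of_injective (f := fun a : x => (⟨F a.1, hF a.1 a.2⟩ : y)) fun a b hab =>
      Subtype.ext (hinj _ a.2 _ b.2 (congrArg Subtype.val hab))

variable [CountableInterFilter (U : Filter I)]

/-- An injection `F` acts on representatives pointwise, as `j(F)` would. -/
theorem card_ultraEmb_le_of_card_le {x y : ZFSet.{u}} (h : x.card ≤ y.card) :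
    (ultraEmb U x).card ≤ (ultraEmb U y).card := by
  classical
  obtain ⟨F, hF, hinj⟩ := ZFSet.card_le_card_iff.1 h
  have hrep : ∀ w : ZFSet.{u}, ∃ f : I → ZFSet.{u}, w ∈ ultraEmb U x →
      (∀ᶠ i in (U : Filter I), f i ∈ x) ∧ ultraCollapse U f = w := fun w => by
    by_cases hw : w ∈ ultraEmb U x
    · obtain ⟨f, hf, he⟩ := mem_ultraCollapse.1 hw
      exact ⟨f, fun _ => ⟨hf, he⟩⟩
    · exact ⟨fun _ => ∅, fun h => absurd h hw⟩
  choose rep hrep using hrep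
  refine ZFSet.card_le_card_iff.2 ⟨fun w => ultraCollapse U fun i => F (rep w i),
    fun a ha => ?_, fun a ha b hb hab => ?_⟩
  · exact ultraCollapse_mem_ultraCollapse.2 ((hrep a ha).1.mono fun i hi => hF _ hi)
  · rw [← (hrep a ha).2, ← (hrep b hb).2, ultraCollapse_eq_ultraCollapse]
    filter_upwards [ultraCollapse_eq_ultraCollapse.1 hab, (hrep a ha).1, (hrep b hb).1]
      with i h1 h2 h3
    exact hinj _ h2 _ h3 h1

theorem card_ultraEmb_le (x : ZFSet.{u}) : (ultraEmb U x).card ≤ x.card ^ #I := by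
  classical
  let T : (I → Shrink.{u} x) → ZFSet.{u} := fun h =>
    ultraCollapse U fun i => ((equivShrink x).symm (h i)).1
  have hsub : ultraEmb U x ⊆ ZFSet.range T := fun w hw => by
    obtain ⟨f, hf, rfl⟩ := mem_ultraCollapse.1 hw
    obtain ⟨i₀, hi₀⟩ := hf.exists
    rw [ZFSet.mem_range]
    refine ⟨fun i => equivShrink x (if hi : f i ∈ x then ⟨f i, hi⟩ else ⟨f i₀, hi₀⟩), ?_⟩
    refine ultraCollapse_congr (hf.mono fun i (hi : f i ∈ x) => ?_)
    simp only [Equiv.symm_apply_apply, dif_pos hi]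
  refine (ZFSet.card_mono hsub).trans ?_
  have := ZFSet.lift_card_range_le (f := T)
  rw [Cardinal.lift_id, Cardinal.lift_id] at this
  refine this.trans ?_
  rw [ZFSet.card, power_def]

theorem isOrdinal_ultraCollapse {f : I → ZFSet.{u}}
    (hf : ∀ᶠ i in (U : Filter I), (f i).IsOrdinal) : (ultraCollapse U f).IsOrdinal where
  isTransitive y hy z hz := by
    obtain ⟨g, hg, rfl⟩ := mem_ultraCollapse.1 hy
    obtain ⟨h, hh, rfl⟩ := mem_ultraCollapse.1 hz
    refine ultraCollapse_mem_ultraCollapse.2 ?_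
    filter_upwards [hf, hg, hh] with i h1 h2 h3
    exact h1.isTransitive _ h2 h3
  mem_trans' {y z w} hyz hzw hw := by
    obtain ⟨c, hc, rfl⟩ := mem_ultraCollapse.1 hw
    obtain ⟨b, hb, rfl⟩ := mem_ultraCollapse.1 hzw
    obtain ⟨a, ha, rfl⟩ := mem_ultraCollapse.1 hyz
    refine ultraCollapse_mem_ultraCollapse.2 ?_
    filter_upwards [hf, ha, hb, hc] with i h0 h1 h2 h3
    exact h0.mem_trans' h1 h2 h3

theorem rank_le_rank_ultraEmb (x : ZFSet.{u}) : x.rank ≤ (ultraEmb U x).rank := by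
  induction x using ZFSet.inductionOn with
  | _ x ih =>
    exact ZFSet.rank_le_iff.2 fun y hy =>
      (ih y hy).trans_lt (ZFSet.rank_lt_of_mem (ultraEmb_mem_ultraEmb.2 hy))

/-- The image is an ordinal whose members all have size below `κ`, hence at most `κ.ord`; and `j`
never lowers ranks. -/
theorem ultraEmb_toZFSet_ord_eq {κ : Cardinal.{u}}
    (h : ∀ y ∈ ultraEmb U κ.ord.toZFSet, y.card < κ) :
    ultraEmb U κ.ord.toZFSet = κ.ord.toZFSet := by
  have hord : (ultraEmb U κ.ord.toZFSet).IsOrdinal :=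
    isOrdinal_ultraCollapse (Eventually.of_forall fun _ => ZFSet.isOrdinal_toZFSet _)
  rw [← hord.toZFSet_rank_eq]
  congr 1
  refine le_antisymm (le_of_forall_lt fun β hβ => ?_) ?_
  · rw [lt_ord, ← Ordinal.card_toZFSet]
    refine h _ ?_
    rw [← hord.toZFSet_rank_eq]
    exact Ordinal.toZFSet_mem_toZFSet_iff.2 hβ
  · conv_lhs => rw [← Ordinal.rank_toZFSet κ.ord]
    exact rank_le_rank_ultraEmb _

variable [CardinalInterFilter (U : Filter I) #I]

/-- By continuity `j(ρ)` is the union of the `j(β)` for `β < ρ`, each of size at most `ρ`. -/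
theorem card_ultraEmb_toZFSet_ord_le {ρ : Cardinal.{u}} (hρ : ℵ₀ ≤ ρ) (hcof : ρ.ord.cof ≠ #I)
    (hpow : ∀ μ < ρ, μ ^ #I ≤ ρ) : (ultraEmb U ρ.ord.toZFSet).card ≤ ρ := by
  let T : ρ.ord.ToType → ZFSet.{u} := fun b => ultraEmb U (b.toOrd : Ordinal).toZFSet
  have hsub : ultraEmb U ρ.ord.toZFSet ⊆ ZFSet.iUnion T := fun w hw => by
    obtain ⟨f, hf, rfl⟩ := mem_ultraCollapse.1 hw
    obtain ⟨β, hβ, hfβ⟩ := exists_eventually_mem_toZFSet (isSuccLimit_ord hρ) hcof hf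
    refine ZFSet.mem_iUnion.2 ⟨Ordinal.ToType.mk ⟨β, hβ⟩, ?_⟩
    dsimp only [T, Ordinal.ToType.toOrd]
    rw [OrderIso.symm_apply_apply]
    exact ultraCollapse_mem_ultraCollapse.2 hfβ
  refine (ZFSet.card_mono hsub).trans ?_
  have := ZFSet.lift_card_iUnion_le_sum_card (f := T)
  rw [Cardinal.lift_id] at this
  refine this.trans ((sum_le_sum _ (fun _ => ρ) fun b => ?_).trans ?_)
  · refine (card_ultraEmb_le _).trans ?_
    rw [Ordinal.card_toZFSet]
    exact hpow _ (lt_ord.1 b.toOrd.2)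
  · rw [sum_const', mk_toType, card_ord, mul_eq_self hρ]

theorem ultraEmb_toZFSet_ord_eq_of_bound {κ : Cardinal.{u}} (hκ : ℵ₀ ≤ κ) (hcof : κ.ord.cof ≠ #I)
    (h : ∀ β < κ.ord, (ultraEmb U β.toZFSet).card < κ) :
    ultraEmb U κ.ord.toZFSet = κ.ord.toZFSet := by
  refine ultraEmb_toZFSet_ord_eq fun y hy => ?_
  obtain ⟨f, hf, rfl⟩ := mem_ultraCollapse.1 hy
  obtain ⟨β, hβ, hfβ⟩ := exists_eventually_mem_toZFSet (isSuccLimit_ord hκ) hcof hf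
  refine (ZFSet.card_mono (ultraCollapse_subset_ultraCollapse ?_)).trans_lt (h β hβ)
  exact hfβ.mono fun i hi => (ZFSet.isOrdinal_toZFSet β).isTransitive _ hi

end Ultrapower

section Measurable

open Filter Cardinal

/-! ### Measurable cardinals -/

theorem GCHFrom.power_le {δ μ ν : Cardinal.{u}} (h : GCHFrom δ) (hδ : ℵ₀ ≤ δ) (hμ : μ < ν)
    (hν : δ < ν) : μ ^ δ ≤ ν := by
  have hm : ℵ₀ ≤ max μ δ := hδ.trans (le_max_right _ _)
  calc μ ^ δ ≤ max μ δ ^ max μ δ :=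
        (power_le_power_right (le_max_left _ _)).trans
          (power_le_power_left (aleph0_pos.trans_le hm).ne' (le_max_right _ _))
    _ = 2 ^ max μ δ := power_self_eq hm
    _ = Order.succ (max μ δ) := h _ (le_max_right _ _)
    _ ≤ ν := Order.succ_le_of_lt (max_lt hμ hν)

section Ultrafilter

variable {I : Type u} {U : Ultrafilter I} [CardinalInterFilter (U : Filter I) #I]

theorem notMem_ultrafilter_of_mk_lt (hU : ∀ a : I, {a} ∉ U) {s : Set I} (hs : #s < #I) :
    s ∉ U := by
  intro hmem
  have h : ∀ᶠ i in (U : Filter I), ∀ a : s, i ≠ a.1 :=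
    (eventually_cardinal_forall (c := #I) hs).2 fun a => Ultrafilter.eventually_not.2 (hU a.1)
  obtain ⟨i, h1, h2⟩ := (h.and hmem).exists
  exact h1 ⟨i, h2⟩ rfl

/-- With a smaller cofinality, the enumeration of `I` would be bounded almost everywhere, putting a
small set in `U`. -/
theorem isRegular_of_ultrafilter (hU : ∀ a : I, {a} ∉ U) (hI : ℵ₀ ≤ #I) : (#I).IsRegular := by
  refine ⟨hI, not_lt.1 fun hlt => ?_⟩
  obtain ⟨r, hr, hord⟩ := exists_ord_eq I
  obtain ⟨β, hβ, hf⟩ := exists_eventually_mem_toZFSet (U := U)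
    (f := fun i => (Ordinal.typein r i).toZFSet) (isSuccLimit_ord hI) hlt.ne
    (Eventually.of_forall fun i => by
      rw [hord]
      exact Ordinal.toZFSet_mem_toZFSet_iff.2 (Ordinal.typein_lt_type r i))
  simp only [Ordinal.toZFSet_mem_toZFSet_iff] at hf
  have hβ' := hβ
  rw [hord] at hβ'
  obtain ⟨b, rfl⟩ := Ordinal.typein_surj r hβ'
  simp only [Ordinal.typein_lt_typein] at hf
  exact notMem_ultrafilter_of_mk_lt hU (lt_ord.1 hβ) hf

/-- Given an injection `e` of `I` into the subsets of `N`, `U` decides each `n ∈ e i`; by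
completeness `e` is constant on a set in `U`, which is then a singleton. -/
theorem two_power_lt_of_ultrafilter (hU : ∀ a : I, {a} ∉ U) {N : Type u} (hN : #N < #I) :
    2 ^ #N < #I := by
  by_contra! hle
  rw [← mk_set] at hle
  obtain ⟨e⟩ := hle
  have h : ∀ᶠ i in (U : Filter I), ∀ n : N, n ∈ e i ↔ ∀ᶠ j in (U : Filter I), n ∈ e j := by
    refine (eventually_cardinal_forall (c := #I) hN).2 fun n => ?_
    rcases Ultrafilter.em U fun i => n ∈ e i with hn | hn
    · exact hn.mono fun i hi => ⟨fun _ => hn, fun _ => hi⟩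
    · exact hn.mono fun i hi => ⟨fun h => absurd h hi, fun h => by
        obtain ⟨j, h1, h2⟩ := (h.and hn).exists
        exact absurd h1 h2⟩
  obtain ⟨a, ha⟩ := h.exists
  refine hU a (mem_of_superset h fun i hi => e.injective (Set.ext fun n => ?_))
  exact (hi n).trans (ha n).symm

end Ultrafilter

theorem IsMeasurableCardinal.exists_ultrafilter {δ : Cardinal.{u}} (h : IsMeasurableCardinal δ) :
    ∃ (I : Type u) (U : Ultrafilter I), #I = δ ∧ ℵ₀ < #I ∧ (∀ a : I, {a} ∉ U) ∧
      CardinalInterFilter (U : Filter I) #I := by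
  obtain ⟨hδ, U, hU, hcomp⟩ := h
  exact ⟨δ.out, U, mk_out δ, by rwa [mk_out], hU, by rwa [mk_out]⟩

theorem IsMeasurableCardinal.isRegular {δ : Cardinal.{u}} (h : IsMeasurableCardinal δ) :
    δ.IsRegular := by
  obtain ⟨I, U, rfl, hI, hU, hcomp⟩ := h.exists_ultrafilter
  exact isRegular_of_ultrafilter hU hI.le

theorem IsMeasurableCardinal.ne_succ {δ : Cardinal.{u}} (h : IsMeasurableCardinal δ)
    (ν : Cardinal.{u}) : δ ≠ Order.succ ν := by
  obtain ⟨I, U, rfl, hI, hU, hcomp⟩ := h.exists_ultrafilter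
  intro he
  have hlt : ν < #I := he ▸ Order.lt_succ ν
  rw [← mk_out ν] at hlt
  have h2 := two_power_lt_of_ultrafilter hU hlt
  rw [mk_out, he, Order.lt_succ_iff] at h2
  exact (cantor ν).not_ge h2

/-! ### The main theorem -/

theorem exists_cof_eq_of_isGoodSigma1WellOrdering {δ κ : Cardinal.{u}}
    (hδ : IsMeasurableCardinal δ) (hGCH : GCHFrom δ) (hκ : δ ≤ κ)
    (hgood : ∃ r : ZFSet.{u} → ZFSet.{u} → Prop,
      IsGoodSigma1WellOrdering ![κ.ord.toZFSet] κ.ord.toZFSet.powerset r) :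
    ∃ ν : Cardinal.{u}, ν.ord.cof = δ ∧ ν ≤ κ ∧ κ ≤ Order.succ ν := by
  by_contra! hcon
  have hreg := hδ.isRegular
  have hcof : κ.ord.cof ≠ δ := fun h => (hcon κ h le_rfl).not_ge (Order.le_succ κ)
  have hlt : δ < κ := hκ.lt_of_ne fun h => hcof (h ▸ hreg.cof_ord)
  obtain ⟨I, U, rfl, hI, hU, hcomp⟩ := hδ.exists_ultrafilter
  have : CountableInterFilter (U : Filter I) := hcomp.toCountableInterFilter _ hI
  have hκ₀ : ℵ₀ ≤ κ := hI.le.trans hκ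
  have hfix : ultraEmb U κ.ord.toZFSet = κ.ord.toZFSet := by
    refine ultraEmb_toZFSet_ord_eq_of_bound hκ₀ hcof fun β hβ => ?_
    have hβ' : β.card < κ := lt_ord.1 hβ
    by_cases hsucc : ∃ ρ, κ = Order.succ ρ
    · obtain ⟨ρ, rfl⟩ := hsucc
      -- Ordinals of size `ρ` need continuity at `ρ`: the crude bound `ρ ^ #I` may reach `κ`. The
      -- cofinality condition holds since `ρ` would otherwise witness (i).
      have hρcof : ρ.ord.cof ≠ #I := fun h => (hcon ρ h (Order.le_succ ρ)).false
      have hρ : #I < ρ := (Order.le_of_lt_succ hlt).lt_of_ne fun h => hρcof (h ▸ hreg.cof_ord)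
      refine lt_of_le_of_lt ?_ (Order.lt_succ ρ)
      refine (card_ultraEmb_le_of_card_le (y := ρ.ord.toZFSet) ?_).trans
        (card_ultraEmb_toZFSet_ord_le (hI.le.trans hρ.le) hρcof fun μ hμ =>
          hGCH.power_le hI.le hμ hρ)
      rw [Ordinal.card_toZFSet, Ordinal.card_toZFSet, card_ord]
      exact Order.le_of_lt_succ hβ'
    · push Not at hsucc
      refine (card_ultraEmb_le _).trans_lt ?_
      rw [Ordinal.card_toZFSet]
      have hm := max_lt hβ' hlt
      have hm' : Order.succ (max β.card #I) < κ :=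
        (Order.succ_le_of_lt hm).lt_of_ne fun h => hsucc _ h.symm
      refine (hGCH.power_le hI.le (ν := Order.succ (max β.card #I)) ?_ ?_).trans_lt hm'
      · exact Order.lt_succ_of_le (le_max_left _ _)
      · exact Order.lt_succ_of_le (le_max_right _ _)
  obtain ⟨r, hr⟩ := hgood
  refine sep_ultraEmb_notMem_range hU hI.le hfix ?_
    (mem_range_ultraCollapse_of_isGoodSigma1WellOrdering hfix hr ZFSet.sep_subset)
  rwa [Ordinal.card_toZFSet, card_ord]

end Measurable

theorem mainTheorem4 (δ κ : Cardinal.{u}) (hδ : IsMeasurableCardinal δ) (hGCH : GCHFrom δ)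
    (hκ : δ ≤ κ)
    (hgood : ∃ r : ZFSet.{u} → ZFSet.{u} → Prop,
      IsGoodSigma1WellOrdering ![κ.ord.toZFSet] κ.ord.toZFSet.powerset r) :
    (∃ ν : Cardinal.{u}, ν.ord.cof = δ ∧ ν ≤ κ ∧ κ ≤ Order.succ ν) ∧
      ∀ ε : Cardinal.{u}, δ < ε → ε ≤ κ → ¬ IsMeasurableCardinal ε := by
  have hi := exists_cof_eq_of_isGoodSigma1WellOrdering hδ hGCH hκ hgood
  refine ⟨hi, fun ε hδε hεκ hε => ?_⟩
  obtain ⟨ν, hν, hνκ, hκν⟩ := hi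
  obtain ⟨μ, hμ, hμκ, hκμ⟩ := exists_cof_eq_of_isGoodSigma1WellOrdering hε
    (fun μ hμ => hGCH μ (hδε.le.trans hμ)) hεκ hgood
  have hδν : δ ≤ ν := hν ▸ Ordinal.cof_ord_le ν
  have hεμ : ε ≤ μ := hμ ▸ Ordinal.cof_ord_le μ
  have hδ₀ := hδ.isRegular.aleph0_le
  rcases lt_trichotomy ν μ with h | h | h
  · have he : μ = Order.succ ν := (hμκ.trans hκν).antisymm (Order.succ_le_of_lt h)
    rw [he, (Cardinal.isRegular_succ (hδ₀.trans hδν)).cof_ord] at hμ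
    exact hε.ne_succ ν hμ.symm
  · rw [h, hμ] at hν
    exact hδε.ne' hν
  · have he : ν = Order.succ μ := (hνκ.trans hκμ).antisymm (Order.succ_le_of_lt h)
    rw [he, (Cardinal.isRegular_succ (hδ₀.trans (hδε.le.trans hεμ))).cof_ord] at hν
    exact (hδε.trans_le (hεμ.trans (hν ▸ Order.le_succ μ))).false
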